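/- For an integer $n\ge 0$ let $[n]_q=1+q+\dots+q^{n-1}\in\mathbb Z[q]$ (so $[0]_q=0$). For $n\ge 1$ and $k\ge 0$ let Williams' $q$-Eulerian numbers be $$\hat E_{k,n}(q)=q^{k-k^2}\sum_{i=0}^{k-1}(-1)^i\,[k-i]_q^{\,n}\,q^{k(i-1)}\left(\binom ni q^{k-i}+\binom n{i-1}\right)\in\mathbb Z[q,q^{-1}],$$ where $\binom{n}{-1}=0$, and let $$\hat E(q,x,y)=1+\sum_{n\ge 1}\sum_{k\ge 0}\hat E_{k,n}(q)\,y^k x^n .$$ Then, as formal power series in $x$ with coefficients in $\mathbb Z[q,q^{-1}][[y]]$, $$\hat E(q,x,y)=\cfrac{1}{1-b_0x-\cfrac{\lambda_1x^2}{1-b_1x-\cfrac{\lambda_2x^2}{1-b_2x-\cfrac{\lambda_3x^2}{\ddots}}}},\qquad b_n=y[n+1]_q+[n]_q,\quad \lambda_n=y[n]_q^2,$$ where the infinite continued fraction is the coefficientwise limit of its finite truncations: for each $d$, the coefficient of $x^d$ in the truncation to $N$ levels equals that of $\hat E(q,x,y)$ for all sufficiently large $N$. -/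

import Mathlib

open scoped LaurentPolynomial PowerSeries

noncomputable section

namespace JacobiQEulerian

/-- The `q`-integer `[n]_q = 1 + q + ⋯ + q ^ (n - 1)`, as an element of `ℤ[q, q⁻¹]`
(the variable `q` is `LaurentPolynomial.T 1`, and `q ^ m` is `LaurentPolynomial.T m`). -/
def qInt (n : ℕ) : ℤ[T;T⁻¹] :=
  ∑ j ∈ Finset.range n, LaurentPolynomial.T (j : ℤ)

/-- The binomial coefficient `n choose (i - 1)`, which is `0` when `i = 0`. -/
def choosePred (n i : ℕ) : ℕ :=
  if i = 0 then 0 else n.choose (i - 1)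

/-- Williams' `q`-Eulerian numbers
`Ê_{k,n}(q) = q^(k-k²) ∑_{i=0}^{k-1} (-1)^i [k-i]_q^n q^(k(i-1)) (C(n,i) q^(k-i) + C(n,i-1))`.
They are used for `n ≥ 1`. -/
def qEulerian (k n : ℕ) : ℤ[T;T⁻¹] :=
  LaurentPolynomial.T ((k : ℤ) - (k : ℤ) ^ 2) *
    ∑ i ∈ Finset.range k,
      (-1) ^ i * qInt (k - i) ^ n * LaurentPolynomial.T ((k : ℤ) * ((i : ℤ) - 1)) *
        ((n.choose i : ℤ[T;T⁻¹]) * LaurentPolynomial.T ((k : ℤ) - (i : ℤ)) +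
          (choosePred n i : ℤ[T;T⁻¹]))

/-- The ring `ℤ[q, q⁻¹]⟦y⟧` of coefficients of the powers of `x`. -/
abbrev CoeffRing : Type := (ℤ[T;T⁻¹])⟦X⟧

/-- The generating function `Ê(q, x, y) = 1 + ∑_{n ≥ 1} ∑_k Ê_{k,n}(q) y^k x^n`, a power series
in `x` over `ℤ[q, q⁻¹]⟦y⟧`. The term `n = 0` is `1` (the empty permutation). -/
def qEulerianSeries : CoeffRing⟦X⟧ :=
  PowerSeries.mk fun n =>
    if n = 0 then 1 else PowerSeries.mk fun k => qEulerian k n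

variable {R : Type*} [CommRing R]

/-- The denominator `1 - b x - c x² G`. -/
def jDenom (b c : R) (G : R⟦X⟧) : R⟦X⟧ :=
  1 - PowerSeries.C b * PowerSeries.X - PowerSeries.C c * PowerSeries.X ^ 2 * G

/-- The finite continued fraction
`1 / (1 - b_m x - lam_{m+1} x² / (1 - b_{m+1} x - lam_{m+2} x² / ( ⋯ )))`
with `N` levels, starting at level `m`; for `N = 0` it is `0`. -/
def jConvergent (b lam : ℕ → R) : ℕ → ℕ → R⟦X⟧
  | 0, _ => 0
  | N + 1, m =>
      PowerSeries.invOfUnit (jDenom (b m) (lam (m + 1)) (jConvergent b lam N (m + 1))) 1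

/-- The inverse in `jConvergent` is an honest inverse. -/
theorem jDenom_mul_jConvergent (b lam : ℕ → R) (N m : ℕ) :
    jDenom (b m) (lam (m + 1)) (jConvergent b lam N (m + 1)) * jConvergent b lam (N + 1) m
      = 1 := by
  rw [jConvergent]
  exact PowerSeries.mul_invOfUnit _ _ (by simp [jDenom])

/-- `F` is equal to the infinite `J`-type continued fraction
`1 / (1 - b_0 x - lam_1 x² / (1 - b_1 x - lam_2 x² / ( ⋯ )))`: the convergents converge to `F` as
formal power series, that is, every coefficient of the convergents is eventually that of `F`. -/
def IsJFraction (F : R⟦X⟧) (b lam : ℕ → R) : Prop :=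
  ∀ d : ℕ, ∀ᶠ N in Filter.atTop,
    PowerSeries.coeff d (jConvergent b lam N 0) = PowerSeries.coeff d F

/-- `b_n = y [n+1]_q + [n]_q`. -/
def bCoeff (n : ℕ) : CoeffRing :=
  PowerSeries.X * PowerSeries.C (qInt (n + 1)) + PowerSeries.C (qInt n)

/-- `λ_n = y [n]_q²`. -/
def lamCoeff (n : ℕ) : CoeffRing :=
  PowerSeries.X * PowerSeries.C (qInt n) ^ 2

end JacobiQEulerian

end

/-!
Write `[n]` for the `q`-integer, `a_m = [m] (1 - y q⁻ᵐ)` and `w_m = y^m q^(m-m²) (1 - y q^(-2m))`.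
Substituting `k = m + i` in Williams' formula and summing the binomial series over `i` shows that,
for `n ≥ 1`,
`∑_k Ê_{k,n} y^k = ∑_m w_m a_m ^ n` (`qEulerian_eq_coeff_sum`),
so the `q`-Eulerian polynomials are the moments of a discrete measure. On the other hand, by
Flajolet's theorem (`isJFraction_pathSeries`), the `J`-fraction is the generating function of
`(J ^ n e₀)₀`, where `J` is the Jacobi operator with the entries `b_n` and `λ_n`. It remains to
identify the two linear functionals `f ↦ ∑_m w_m f(a_m)` and `f ↦ (f(J) e₀)₀` on polynomials
(`dvd_sum_mass_sub_jacobi`), and it is enough to do so on the Newton basis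
`φ_k = ∏_{j < k} (a - a_j)`, where both give `y^k q^(-C(k,2)) [k]!`:

* all the coordinates of `φ_k(J) e₀` have a product formula (`newtonVec_formula`), proved by
  induction on `k`, the induction step being one identity between `q`-integers;
* `w_m (φ_{k+1}(a_m) - y q⁻ᵏ [k + 1] φ_k(a_m))` is a difference in `m` (`mass_mul_eq_sub`), so the
  sums `∑_m w_m φ_k(a_m)` satisfy the first-order recurrence in `k` that their value predicts.

As `y ^ m` divides `w_m`, the infinite sums over `m` converge `y`-adically; they are replaced by
finite sums over `m < M` and congruences modulo `y ^ M`.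
-/

noncomputable section

namespace JacobiQEulerian

open Finset

/-! ### Jacobi operators and continued fractions -/

section JacobiOperator

variable {R : Type*} [CommRing R]

/-- The tridiagonal (Jacobi) operator of the coefficient sequences `b` and `lam`, acting on column
vectors indexed by `ℕ`: `1` below the diagonal, `b n` on it and `lam (n + 1)` above it. -/
def jacobi (b lam : ℕ → R) : (ℕ → R) →ₗ[R] (ℕ → R) where
  toFun v n := (if n = 0 then 0 else v (n - 1)) + b n * v n + lam (n + 1) * v (n + 1)
  map_add' v w := by
    funext n
    by_cases h : n = 0 <;> simp [h] <;> ring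
  map_smul' c v := by
    funext n
    by_cases h : n = 0 <;> simp [h] <;> ring

theorem jacobi_apply_zero (b lam : ℕ → R) (v : ℕ → R) :
    jacobi b lam v 0 = b 0 * v 0 + lam 1 * v 1 := by
  simp [jacobi]

theorem jacobi_apply_succ (b lam : ℕ → R) (v : ℕ → R) (n : ℕ) :
    jacobi b lam v (n + 1) = v n + b (n + 1) * v (n + 1) + lam (n + 2) * v (n + 2) := by
  simp [jacobi]

/-- The generating function `∑ (J ^ d e₀) m x ^ d` of the weighted Motzkin paths from height `0`
to height `m`. -/
def pathSeries (b lam : ℕ → R) (m : ℕ) : R⟦X⟧ :=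
  PowerSeries.mk fun d => ((jacobi b lam) ^ d) (Pi.single 0 1) m

theorem pathSeries_zero_eq (b lam : ℕ → R) :
    pathSeries b lam 0 = 1 + PowerSeries.X *
      (PowerSeries.C (b 0) * pathSeries b lam 0 + PowerSeries.C (lam 1) * pathSeries b lam 1) := by
  ext d
  rcases d with _ | d
  · simp [pathSeries]
  · simp [pathSeries, PowerSeries.coeff_succ_X_mul, pow_succ', jacobi_apply_zero,
      PowerSeries.coeff_one]

theorem pathSeries_succ_eq (b lam : ℕ → R) (m : ℕ) :
    pathSeries b lam (m + 1) = PowerSeries.X * (pathSeries b lam m +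
      PowerSeries.C (b (m + 1)) * pathSeries b lam (m + 1) +
      PowerSeries.C (lam (m + 2)) * pathSeries b lam (m + 2)) := by
  ext d
  rcases d with _ | d
  · simp [pathSeries]
  · simp [pathSeries, PowerSeries.coeff_succ_X_mul, pow_succ', jacobi_apply_succ]

/-- The `N`-level convergent started at level `m + 1` approximates the quotient of consecutive path
series, in the denominator-free form `h_{m+1} ≈ c x h_m`. Each level of the fraction gains a
factor `x`. -/
theorem X_pow_dvd_pathSeries_succ_sub (b lam : ℕ → R) (N m : ℕ) :
    (PowerSeries.X : R⟦X⟧) ^ N ∣ pathSeries b lam (m + 1) -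
      jConvergent b lam N (m + 1) * (PowerSeries.X * pathSeries b lam m) := by
  induction N generalizing m with
  | zero => simp
  | succ N ih =>
    obtain ⟨g, hg⟩ := ih (m + 1)
    refine ⟨jConvergent b lam (N + 1) (m + 1) * PowerSeries.C (lam (m + 2)) * g, ?_⟩
    have h1 := jDenom_mul_jConvergent b lam N (m + 1)
    have h2 := pathSeries_succ_eq b lam m
    simp only [jDenom] at h1
    linear_combination (-pathSeries b lam (m + 1)) * h1 +
      jConvergent b lam (N + 1) (m + 1) * h2 +
      jConvergent b lam (N + 1) (m + 1) * PowerSeries.C (lam (m + 2)) * PowerSeries.X * hg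

theorem X_pow_dvd_pathSeries_zero_sub (b lam : ℕ → R) (N : ℕ) :
    (PowerSeries.X : R⟦X⟧) ^ N ∣ pathSeries b lam 0 - jConvergent b lam N 0 := by
  rcases N with _ | N
  · simp
  · obtain ⟨g, hg⟩ := X_pow_dvd_pathSeries_succ_sub b lam N 0
    refine ⟨jConvergent b lam (N + 1) 0 * PowerSeries.C (lam 1) * g, ?_⟩
    have h1 := jDenom_mul_jConvergent b lam N 0
    have h2 := pathSeries_zero_eq b lam
    simp only [jDenom, zero_add] at h1 hg
    linear_combination (-pathSeries b lam 0) * h1 +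
      jConvergent b lam (N + 1) 0 * h2 +
      jConvergent b lam (N + 1) 0 * PowerSeries.C (lam 1) * PowerSeries.X * hg

/-- Flajolet's theorem: the generating function of weighted Motzkin paths from `0` to `0` is the
`J`-fraction with the same weights. -/
theorem isJFraction_pathSeries (b lam : ℕ → R) : IsJFraction (pathSeries b lam 0) b lam := by
  intro d
  filter_upwards [Filter.eventually_gt_atTop d] with N hN
  have h := PowerSeries.X_pow_dvd_iff.1 (X_pow_dvd_pathSeries_zero_sub b lam N) d hN
  rw [map_sub, sub_eq_zero] at h
  exact h.symm

end JacobiOperator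

/-! ### `q`-integers at a unit of a commutative ring -/

section Abstract

variable {R : Type*} [CommRing R] (q p y : R)

/-- The `q`-integer `[n]_q` at an element `q` of a commutative ring. -/
def qNum (n : ℕ) : R := ∑ j ∈ range n, q ^ j

theorem qNum_zero : qNum q 0 = 0 := by simp [qNum]

theorem pow_eq_qNum (n : ℕ) : q ^ n = 1 + (q - 1) * qNum q n := by
  rw [qNum, mul_geom_sum]
  ring

theorem qNum_add (m n : ℕ) : qNum q (m + n) = qNum q m + q ^ m * qNum q n := by
  simp only [qNum, sum_range_add, pow_add, mul_sum]

theorem qNum_succ (n : ℕ) : qNum q (n + 1) = 1 + q * qNum q n := by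
  rw [add_comm, qNum_add]
  simp [qNum]

/-- The `q`-factorial `[n]_q!`. -/
def qFact (n : ℕ) : R := ∏ j ∈ range n, qNum q (j + 1)

theorem qFact_succ (n : ℕ) : qFact q (n + 1) = qFact q n * qNum q (n + 1) := prod_range_succ _ _

/-- The node `a_m = [m]_q (1 - y q⁻ᵐ)`, where `p` stands for `q⁻¹`. -/
def node (m : ℕ) : R := qNum q m * (1 - y * p ^ m)

/-- The vectors `∏_{j < k} (J - a_j) e₀`, where `J` is the Jacobi operator with
`b_n = y [n + 1] + [n]` and `λ_n = y [n]²`. -/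
def newtonVec : ℕ → ℕ → R
  | 0 => Pi.single 0 1
  | k + 1 =>
    jacobi (fun n => y * qNum q (n + 1) + qNum q n) (fun n => y * qNum q n ^ 2) (newtonVec k) -
      node q p y k • newtonVec k

theorem newtonVec_succ_zero (k : ℕ) :
    newtonVec q p y (k + 1) 0 =
      (y * qNum q 1 + qNum q 0 - node q p y k) * newtonVec q p y k 0 +
        y * qNum q 1 ^ 2 * newtonVec q p y k 1 := by
  simp only [newtonVec, Pi.sub_apply, Pi.smul_apply, smul_eq_mul, jacobi_apply_zero]
  ring

theorem newtonVec_succ_succ (k n : ℕ) :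
    newtonVec q p y (k + 1) (n + 1) = newtonVec q p y k n +
      (y * qNum q (n + 2) + qNum q (n + 1) - node q p y k) * newtonVec q p y k (n + 1) +
        y * qNum q (n + 2) ^ 2 * newtonVec q p y k (n + 2) := by
  simp only [newtonVec, Pi.sub_apply, Pi.smul_apply, smul_eq_mul, jacobi_apply_succ]
  ring

theorem newtonVec_eq_zero (k n : ℕ) (h : k < n) : newtonVec q p y k n = 0 := by
  induction k generalizing n with
  | zero => exact Pi.single_eq_of_ne (by omega) _
  | succ k ih =>
    obtain ⟨n, rfl⟩ : ∃ j, n = j + 1 := ⟨n - 1, by omega⟩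
    rw [newtonVec_succ_succ, ih n (by omega), ih (n + 1) (by omega), ih (n + 2) (by omega)]
    ring

variable {q p}

/-- The coefficient identity behind the product formula for `newtonVec`. -/
theorem newton_identity (hqp : q * p = 1) (n r : ℕ) :
    qNum q n ^ 2 * q ^ (r + 1) * y + qNum q (r + 1) * q ^ (n + r) *
      (y * qNum q (n + 1) + qNum q n - node q p y (n + r)) +
      qNum q (r + 1) * qNum q r * q ^ (n + r + n) = qNum q (n + r + 1) ^ 2 * y := by
  have h1 : q ^ (n + r) * p ^ (n + r) = 1 := by rw [← mul_pow, hqp, one_pow]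
  have h2 : qNum q (r + 1) * q ^ (n + r) *
      (y * qNum q (n + 1) + qNum q n - node q p y (n + r)) =
      qNum q (r + 1) * (q ^ (n + r) * (y * qNum q (n + 1) + qNum q n - qNum q (n + r)) +
        y * qNum q (n + r)) := by
    rw [node]
    linear_combination qNum q (r + 1) * y * qNum q (n + r) * h1
  rw [h2]
  simp only [qNum_succ, qNum_add, pow_add, pow_one, pow_eq_qNum q n, pow_eq_qNum q r]
  ring

/-- The coordinates of `newtonVec` have the product formula
`y^(k-n) q^(C(n,2)-C(k,2)) [k]!² / ([n]!² [k-n]!)`, here with `k = n + r`. -/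
theorem newtonVec_formula (hqp : q * p = 1) (k n r : ℕ) (h : n + r = k) :
    qFact q n ^ 2 * qFact q r * q ^ (k.choose 2) * newtonVec q p y k n =
      q ^ (n.choose 2) * qFact q k ^ 2 * y ^ r := by
  induction k generalizing n r with
  | zero =>
    obtain ⟨rfl, rfl⟩ : n = 0 ∧ r = 0 := by omega
    simp [newtonVec, qFact]
  | succ k ih =>
    have hc (j : ℕ) : (j + 1).choose 2 = j + j.choose 2 := by
      rw [Nat.choose_succ_succ' j 1, Nat.choose_one_right]
    rcases r with _ | r
    · obtain rfl : n = k + 1 := by omega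
      have h0 := ih k 0 rfl
      rw [newtonVec_succ_succ, newtonVec_eq_zero q p y k (k + 1) (by omega),
        newtonVec_eq_zero q p y k (k + 2) (by omega), hc, qFact_succ]
      simp only [pow_add] at h0 ⊢
      linear_combination q ^ k * qNum q (k + 1) ^ 2 * h0
    · have hid := newton_identity y hqp n r
      obtain rfl : k = n + r := by omega
      have h0 := ih n r rfl
      -- The term with index `n + 1` vanishes for `r = 0`, consistently with the factor `[r]`.
      have h1 : qFact q n ^ 2 * qFact q (r + 1) * qNum q (n + 1) ^ 2 * q ^ ((n + r).choose 2) *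
          newtonVec q p y (n + r) (n + 1) * y = qNum q (r + 1) * qNum q r *
          q ^ n * q ^ (n.choose 2) * qFact q (n + r) ^ 2 * y ^ r := by
        rcases r with _ | r
        · rw [newtonVec_eq_zero q p y (n + 0) (n + 1) (by omega), qNum_zero]
          ring
        · have := ih (n + 1) r (by omega)
          rw [hc, qFact_succ, pow_add] at this
          rw [qFact_succ, qFact_succ q r]
          linear_combination qNum q (r + 2) * qNum q (r + 1) * y * this
      rcases n with _ | n
      · rw [newtonVec_succ_zero, hc, qFact_succ, qFact_succ q (0 + r)]
        simp only [qNum_zero, zero_add, pow_add, pow_zero] at *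
        rw [qFact_succ] at h1
        linear_combination q ^ r * qNum q (r + 1) *
            (y * qNum q 1 - node q p y r) * h0 + q ^ r * h1 +
            qFact q r ^ 2 * y ^ r * q ^ (Nat.choose 0 2) * hid
      · have h2 := ih n (r + 1) (by omega)
        rw [newtonVec_succ_succ, hc, qFact_succ, qFact_succ q (n + 1 + r)]
        rw [qFact_succ, qFact_succ] at h1
        rw [qFact_succ] at h2
        rw [qFact_succ, hc] at h0
        rw [hc] at h1
        rw [hc n]
        simp only [pow_add, pow_one] at *
        rw [qFact_succ]
        linear_combination
          q ^ n * q * q ^ r * qNum q (r + 1) *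
            (y * qNum q (n + 2) + qNum q (n + 1) - node q p y (n + 1 + r)) * h0 +
          q ^ n * q * q ^ r * h1 + q ^ n * q * q ^ r * qNum q (n + 1) ^ 2 * h2 +
            qFact q (n + 1 + r) ^ 2 * y ^ r * q ^ n * q ^ (Nat.choose n 2) * hid

theorem newtonVec_apply_zero [IsDomain R] (hq : ∀ n, qNum q (n + 1) ≠ 0) (hqp : q * p = 1)
    (k : ℕ) : newtonVec q p y k 0 = y ^ k * p ^ (k.choose 2) * qFact q k := by
  have hk : qFact q k ≠ 0 := prod_ne_zero_iff.2 fun j _ => hq j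
  have h := newtonVec_formula y hqp k 0 k (zero_add k)
  have h1 : q ^ (k.choose 2) * p ^ (k.choose 2) = 1 := by rw [← mul_pow, hqp, one_pow]
  refine mul_left_cancel₀ hk ?_
  simp only [qFact, range_zero, prod_empty, Nat.choose_zero_succ, pow_zero, one_pow] at h
  simp only [qFact] at *
  linear_combination p ^ (k.choose 2) * h -
    newtonVec q p y k 0 * (∏ j ∈ range k, qNum q (j + 1)) * h1

/-! ### The discrete moment functional -/

variable (q p)

/-- The mass `w_m = y^m q^(m-m²) (1 - y q^(-2m))` at the node `a_m`. -/
def mass (m : ℕ) : R := y ^ m * p ^ (m * (m - 1)) * (1 - y * p ^ (2 * m))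

/-- The Newton basis polynomial `∏_{j < k} (a - a_j)` at the node `a_m`. -/
def newtonBasis (k m : ℕ) : R := ∏ j ∈ range k, (node q p y m - node q p y j)

/-- The antidifference certifying that the sum of
`w_m (∏_{j < k} (a_m - a_j)) (a_m - a_k - y q⁻ᵏ [k + 1])` over `m` telescopes. -/
def certificate (k m : ℕ) : R :=
  y ^ m * p ^ (m * (m - 1)) * (∏ j ∈ range (k + 1), (qNum q m - qNum q j)) *
    ((1 - y * (q * p ^ m)) * ∏ j ∈ range k, (1 - y * p ^ (m + j)))

variable {q p}

theorem node_sub_node (hqp : q * p = 1) (m j : ℕ) :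
    node q p y m - node q p y j = (qNum q m - qNum q j) * (1 - y * p ^ (m + j)) := by
  have h1 : q ^ m * p ^ m = 1 := by rw [← mul_pow, hqp, one_pow]
  have h2 : q ^ j * p ^ j = 1 := by rw [← mul_pow, hqp, one_pow]
  rw [pow_eq_qNum] at h1 h2
  rw [node, node, pow_add]
  generalize qNum q m = M at *
  generalize qNum q j = J at *
  generalize p ^ m = a at *
  generalize p ^ j = b at *
  linear_combination y * M * a * h2 - y * J * b * h1

theorem pow_mul_pred_succ (m : ℕ) :
    p ^ ((m + 1) * (m + 1 - 1)) = p ^ (m * (m - 1)) * (p ^ m) ^ 2 := by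
  rw [← pow_mul, ← pow_add]
  congr 1
  rcases m with _ | m
  · rfl
  · simp only [Nat.add_sub_cancel]
    ring

theorem mass_mul_eq_sub (hqp : q * p = 1) (k m : ℕ) :
    mass p y m * (newtonBasis q p y (k + 1) m -
      y * p ^ k * qNum q (k + 1) * newtonBasis q p y k m) =
      certificate q p y k m - certificate q p y k (m + 1) := by
  have hprod : ∏ j ∈ range (k + 1), (qNum q (m + 1) - qNum q j) =
      (q ^ k * ∏ j ∈ range k, (qNum q m - qNum q j)) * qNum q (m + 1) := by
    rw [prod_range_succ', qNum_zero, sub_zero]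
    congr 1
    rw [← card_range k, ← prod_const, card_range, ← prod_mul_distrib]
    refine prod_congr rfl fun j _ => ?_
    rw [qNum_succ, qNum_succ]
    ring
  have hprod' : (1 - y * (q * p ^ (m + 1))) * ∏ j ∈ range k, (1 - y * p ^ (m + 1 + j)) =
      (∏ j ∈ range k, (1 - y * p ^ (m + j))) * (1 - y * p ^ (m + k)) := by
    rw [← prod_range_succ (fun j => 1 - y * p ^ (m + j)), prod_range_succ']
    have : q * p ^ (m + 1) = p ^ (m + 0) := by
      rw [add_zero, pow_succ', ← mul_assoc, hqp, one_mul]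
    rw [this, mul_comm]
    congr 1
    exact prod_congr rfl fun j _ => by rw [add_assoc m 1 j, add_comm 1 j]
  rw [certificate, certificate, hprod, hprod', prod_range_succ, pow_mul_pred_succ]
  simp only [newtonBasis, prod_range_succ, node_sub_node y hqp, prod_mul_distrib]
  have h1 : q ^ m * p ^ m = 1 := by rw [← mul_pow, hqp, one_pow]
  have h2 : q ^ k * p ^ k = 1 := by rw [← mul_pow, hqp, one_pow]
  rw [pow_eq_qNum] at h1 h2
  rw [mass, qNum_succ, qNum_succ, pow_eq_qNum q k, pow_add, two_mul, pow_add]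
  generalize qNum q m = M at *
  generalize qNum q k = K at *
  -- What is left after cancelling the common factor; it follows from `q ^ m * p ^ m = 1` and
  -- `q ^ k * p ^ k = 1`, with `q ^ m` and `q ^ k` written through `[m]` and `[k]`.
  have key : (M - K) * (1 - y * (q * p ^ m)) -
      y * (p ^ m) ^ 2 * (1 + q * M) * (1 + (q - 1) * K) * (1 - y * (p ^ m * p ^ k)) =
      (1 - y * (p ^ m * p ^ m)) *
        ((M - K) * (1 - y * (p ^ m * p ^ k)) - y * p ^ k * (1 + q * K)) := by
    generalize p ^ m = a at *
    generalize p ^ k = b at *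
    clear hprod hprod'
    grind
  linear_combination (-y ^ m * p ^ (m * (m - 1)) * (∏ j ∈ range k, (M - qNum q j)) *
    ∏ j ∈ range k, (1 - y * p ^ (m + j))) * key

/-- Modulo `y ^ M`, the functional `f ↦ ∑_{m < M} w_m f(a_m)` takes the value
`y^k q^(-C(k,2)) [k]!` at the `k`-th Newton basis polynomial. -/
theorem dvd_sum_mass_newtonBasis (hqp : q * p = 1) (M k : ℕ) :
    y ^ M ∣ ∑ m ∈ range M, mass p y m * newtonBasis q p y k m -
      y ^ k * p ^ (k.choose 2) * qFact q k := by
  induction k with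
  | zero =>
    have h (m : ℕ) : mass p y m * newtonBasis q p y 0 m =
        y ^ m * p ^ (m * (m - 1)) - y ^ (m + 1) * p ^ ((m + 1) * (m + 1 - 1)) := by
      rw [pow_mul_pred_succ, mass, newtonBasis]
      simp
      ring
    simp only [h]
    rw [sum_range_sub']
    simp [qFact]
  | succ k ih =>
    have h := sum_congr rfl fun m (_ : m ∈ range M) => mass_mul_eq_sub y hqp k m
    rw [sum_range_sub'] at h
    have h0 : certificate q p y k 0 = 0 := by
      rw [certificate, prod_range_succ', sub_self]
      ring
    simp only [mul_sub, sum_sub_distrib] at h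
    have h1 : ∑ m ∈ range M, mass p y m *
        (y * p ^ k * qNum q (k + 1) * newtonBasis q p y k m) =
        y * p ^ k * qNum q (k + 1) * ∑ m ∈ range M, mass p y m * newtonBasis q p y k m := by
      rw [mul_sum]
      exact sum_congr rfl fun m _ => by ring
    rw [h0, h1] at h
    obtain ⟨c, hc⟩ := ih
    have hT : certificate q p y k M = y ^ M * (p ^ (M * (M - 1)) *
        (∏ j ∈ range (k + 1), (qNum q M - qNum q j)) *
        ((1 - y * (q * p ^ M)) * ∏ j ∈ range k, (1 - y * p ^ (M + j)))) := by
      rw [certificate]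
      ring
    rw [hT] at h
    rw [Nat.choose_succ_succ' k 1, Nat.choose_one_right, qFact_succ, pow_add, pow_succ]
    refine ⟨y * p ^ k * qNum q (k + 1) * c - p ^ (M * (M - 1)) *
        (∏ j ∈ range (k + 1), (qNum q M - qNum q j)) *
        ((1 - y * (q * p ^ M)) * ∏ j ∈ range k, (1 - y * p ^ (M + j))), ?_⟩
    linear_combination h + y * p ^ k * qNum q (k + 1) * hc

/-- The functional `f ↦ (f(J) e₀) 0` agrees with `f ↦ ∑_{m < M} w_m f(a_m)` modulo `y ^ M`, on
the polynomials `a ^ d ∏_{j < k} (a - a_j)`. -/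
theorem dvd_sum_mass_sub_jacobi [IsDomain R] (hq : ∀ n, qNum q (n + 1) ≠ 0) (hqp : q * p = 1)
    (M d k : ℕ) :
    y ^ M ∣ ∑ m ∈ range M, mass p y m * (node q p y m ^ d * newtonBasis q p y k m) -
      ((jacobi (fun n => y * qNum q (n + 1) + qNum q n) (fun n => y * qNum q n ^ 2)) ^ d)
        (newtonVec q p y k) 0 := by
  induction d generalizing k with
  | zero =>
    simpa [newtonVec_apply_zero y hq hqp] using dvd_sum_mass_newtonBasis y hqp M k
  | succ d ih =>
    have hJ : jacobi (fun n => y * qNum q (n + 1) + qNum q n) (fun n => y * qNum q n ^ 2)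
        (newtonVec q p y k) = newtonVec q p y (k + 1) + node q p y k • newtonVec q p y k := by
      simp [newtonVec]
    have hs (m : ℕ) : mass p y m * (node q p y m ^ (d + 1) * newtonBasis q p y k m) =
        mass p y m * (node q p y m ^ d * newtonBasis q p y (k + 1) m) +
          node q p y k * (mass p y m * (node q p y m ^ d * newtonBasis q p y k m)) := by
      rw [newtonBasis, newtonBasis, prod_range_succ]
      ring
    simp only [hs, sum_add_distrib, ← mul_sum]
    rw [pow_succ, Module.End.mul_apply, hJ, map_add, map_smul]
    simp only [Pi.add_apply, Pi.smul_apply, smul_eq_mul]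
    convert dvd_add (ih (k + 1)) (dvd_mul_of_dvd_right (ih k) (node q p y k)) using 1
    ring

end Abstract

/-! ### Williams' numbers as moments -/

open LaurentPolynomial in
theorem qNum_C_T (n : ℕ) :
    qNum (PowerSeries.C (T 1 : ℤ[T;T⁻¹])) n = PowerSeries.C (qInt n) := by
  simp [qNum, qInt, ← map_pow, T_pow]

theorem qInt_succ_ne_zero (n : ℕ) : qInt (n + 1) ≠ 0 := by
  -- The specialization `q = 1` sends `[n + 1]` to `n + 1`.
  intro h
  have := congrArg (LaurentPolynomial.eval₂ (RingHom.id ℤ) 1) h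
  simp [qInt] at this
  omega

theorem coeff_one_sub_mul_pow {S : Type*} [CommRing S] (s : S) (n i : ℕ) :
    PowerSeries.coeff i ((1 - PowerSeries.X * PowerSeries.C s) ^ n) =
      (-1) ^ i * s ^ i * (n.choose i : S) := by
  induction n generalizing i with
  | zero => rcases i with _ | i <;> simp [PowerSeries.coeff_one]
  | succ n ih =>
    rw [pow_succ', sub_mul, one_mul, map_sub, ih]
    rcases i with _ | i
    · simp [mul_assoc]
    · rw [mul_assoc PowerSeries.X, PowerSeries.coeff_succ_X_mul, PowerSeries.coeff_C_mul, ih,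
        Nat.choose_succ_succ', Nat.cast_add]
      ring

theorem coeff_mass_factor {S : Type*} [CommRing S] (s : S) (n i : ℕ) :
    PowerSeries.coeff i ((1 - PowerSeries.X * PowerSeries.C (s ^ 2)) *
      (1 - PowerSeries.X * PowerSeries.C s) ^ n) =
      (-1) ^ i * s ^ i * ((n.choose i : S) + s * (choosePred n i : S)) := by
  rw [sub_mul, one_mul, map_sub, coeff_one_sub_mul_pow]
  rcases i with _ | i
  · simp [choosePred, mul_assoc]
  · rw [mul_assoc PowerSeries.X, PowerSeries.coeff_succ_X_mul, PowerSeries.coeff_C_mul, coeff_one_sub_mul_pow]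
    simp only [choosePred, Nat.add_sub_cancel, if_neg (Nat.succ_ne_zero i)]
    ring

open LaurentPolynomial in
theorem qEulerian_eq_coeff_sum (k n : ℕ) (hn : n ≠ 0) :
    PowerSeries.coeff k (∑ m ∈ range (k + 1),
      mass (PowerSeries.C (T (-1) : ℤ[T;T⁻¹])) PowerSeries.X m *
        node (PowerSeries.C (T 1 : ℤ[T;T⁻¹])) (PowerSeries.C (T (-1))) PowerSeries.X m ^ n) =
      qEulerian k n := by
  have hterm (m i : ℕ) : PowerSeries.coeff (i + m)
      (mass (PowerSeries.C (T (-1) : ℤ[T;T⁻¹])) PowerSeries.X m *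
        node (PowerSeries.C (T 1 : ℤ[T;T⁻¹])) (PowerSeries.C (T (-1))) PowerSeries.X m ^ n) =
      T (-(m * (m - 1) : ℤ)) * qInt m ^ n *
        ((-1) ^ i * T (-(m * i : ℤ)) * ((n.choose i : ℤ[T;T⁻¹]) +
          T (-(m : ℤ)) * (choosePred n i : ℤ[T;T⁻¹]))) := by
    have hm : ((m * (m - 1) : ℕ) : ℤ) = m * (m - 1 : ℤ) := by
      rcases m with _ | m <;> simp
    have hfac : mass (PowerSeries.C (T (-1) : ℤ[T;T⁻¹])) PowerSeries.X m *
        node (PowerSeries.C (T 1 : ℤ[T;T⁻¹])) (PowerSeries.C (T (-1))) PowerSeries.X m ^ n =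
        PowerSeries.X ^ m * (PowerSeries.C (T (-(m * (m - 1) : ℤ)) * qInt m ^ n) *
          ((1 - PowerSeries.X * PowerSeries.C (T (-(m : ℤ)) ^ 2)) *
            (1 - PowerSeries.X * PowerSeries.C (T (-(m : ℤ)))) ^ n)) := by
      have e1 : (T (-(m * (m - 1) : ℤ)) : ℤ[T;T⁻¹]) = T (-1) ^ (m * (m - 1)) := by
        rw [T_pow, hm]
        ring_nf
      have e2 : (T (-(m : ℤ)) : ℤ[T;T⁻¹]) = T (-1) ^ m := by
        rw [T_pow]
        ring_nf
      rw [e1, e2, mass, node, qNum_C_T, mul_pow]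
      simp only [map_mul, map_pow]
      ring
    rw [hfac, PowerSeries.coeff_X_pow_mul, PowerSeries.coeff_C_mul, coeff_mass_factor, T_pow]
    rw [show (i : ℤ) * -(m : ℤ) = -(m * i : ℤ) by ring]
  rw [map_sum, sum_range_succ']
  have h0 : node (PowerSeries.C (T 1 : ℤ[T;T⁻¹])) (PowerSeries.C (T (-1))) PowerSeries.X 0 = 0 := by
    simp [node, qNum_zero]
  rw [h0, zero_pow hn, mul_zero, map_zero, add_zero, qEulerian, mul_sum, ← sum_range_reflect]
  refine sum_congr rfl fun i hi => ?_
  obtain ⟨m, rfl⟩ : ∃ m, k = i + (m + 1) := ⟨k - 1 - i, by have := mem_range.1 hi; omega⟩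
  rw [show i + (m + 1) - 1 - i + 1 = m + 1 by omega, hterm,
    show i + (m + 1) - i = m + 1 by omega]
  push_cast
  have e1 : (T ((i + (m + 1) : ℤ) - (i + (m + 1)) ^ 2) * T ((i + (m + 1) : ℤ) * (i - 1)) *
      T ((i + (m + 1) : ℤ) - i) : ℤ[T;T⁻¹]) =
      T (-((m + 1) * (m + 1 - 1) : ℤ)) * T (-((m + 1) * i : ℤ)) := by
    simp only [← T_add]
    congr 1
    ring
  have e2 : (T ((i + (m + 1) : ℤ) - (i + (m + 1)) ^ 2) * T ((i + (m + 1) : ℤ) * (i - 1)) :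
      ℤ[T;T⁻¹]) =
      T (-((m + 1) * (m + 1 - 1) : ℤ)) * T (-((m + 1) * i : ℤ)) * T (-(m + 1 : ℤ)) := by
    simp only [← T_add]
    congr 1
    ring
  linear_combination (-(-1) ^ i * qInt (m + 1) ^ n * (n.choose i : ℤ[T;T⁻¹])) * e1 -
    (-1) ^ i * qInt (m + 1) ^ n * (choosePred n i : ℤ[T;T⁻¹]) * e2

theorem qEulerianSeries_eq_pathSeries :
    qEulerianSeries = pathSeries bCoeff lamCoeff 0 := by
  ext n : 1
  rw [qEulerianSeries, pathSeries, PowerSeries.coeff_mk, PowerSeries.coeff_mk]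
  split_ifs with hn
  · subst hn
    simp
  · ext k
    have hqp : (PowerSeries.C (LaurentPolynomial.T 1 : ℤ[T;T⁻¹]) : CoeffRing) *
        PowerSeries.C (LaurentPolynomial.T (-1)) = 1 := by
      rw [← map_mul, ← LaurentPolynomial.T_add]
      simp
    have hq (j : ℕ) : qNum (PowerSeries.C (LaurentPolynomial.T 1 : ℤ[T;T⁻¹])) (j + 1) ≠ 0 := by
      rw [qNum_C_T]
      exact fun h => qInt_succ_ne_zero j (PowerSeries.C_injective (h.trans (map_zero _).symm))
    have h := PowerSeries.X_pow_dvd_iff.1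
      (dvd_sum_mass_sub_jacobi PowerSeries.X hq hqp (k + 1) n 0) k (Nat.lt_succ_self k)
    rw [map_sub, sub_eq_zero] at h
    simp only [newtonBasis, range_zero, prod_empty, mul_one] at h
    rw [qEulerian_eq_coeff_sum k n hn] at h
    rw [PowerSeries.coeff_mk, h]
    have hb : (fun j => PowerSeries.X * qNum (PowerSeries.C (LaurentPolynomial.T 1 : ℤ[T;T⁻¹]))
        (j + 1) + qNum (PowerSeries.C (LaurentPolynomial.T 1)) j) = bCoeff := by
      funext j
      rw [qNum_C_T, qNum_C_T, bCoeff]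
    have hl : (fun j => PowerSeries.X * qNum (PowerSeries.C (LaurentPolynomial.T 1 : ℤ[T;T⁻¹]))
        j ^ 2) = lamCoeff := by
      funext j
      rw [qNum_C_T, lamCoeff]
    rw [hb, hl, newtonVec]

end JacobiQEulerian

end

theorem theorem1 :
    JacobiQEulerian.IsJFraction JacobiQEulerian.qEulerianSeries
      JacobiQEulerian.bCoeff JacobiQEulerian.lamCoeff := by
  rw [JacobiQEulerian.qEulerianSeries_eq_pathSeries]
  exact JacobiQEulerian.isJFraction_pathSeries _ _
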